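/- Let $n\ge 1$, let $\mathbf{F}_q$ be a finite field with $q$ elements, and let $M\in \mathrm{GL}_n(\mathbf{F}_q)$. The similarity class of $M$ is determined by a finite set $\mathcal F$ of monic irreducible polynomials over $\mathbf{F}_q$ and, for each $f\in\mathcal F$, a partition $\lambda_f$ of a positive integer with parts $\lambda_f(j)$, such that $\mathbf{F}_q^n$, regarded as an $\mathbf{F}_q[x]$-module with $x$ acting as $M$, is isomorphic to $\bigoplus_{f\in\mathcal F}\bigoplus_j \mathbf{F}_q[x]/(f^{\lambda_f(j)})$. The class type of $M$ is the formal unordered product of the terms $d^{\lambda_f}$, where $f \in\mathcal F$ and $d=\deg f$. The part-size invariant of $M$ is the highest common factor of all the parts of all the partitions occurring in its class type. For a group $G$ and a subgroup $H\trianglelefteq G$ with $G/H$ abelian, the centralizing subgroup of a conjugacy class $C$ of $G$ with respect to $H$ is $\mathrm{Cent}_G(g)\cdot H$, where $g\in C$ is arbitrary (the subgroup does not depend on the choice of $g$). Corollary. Let $M\in\mathrm{GL}_n(\mathbf{F}_q)$ have part-size invariant $k$, and let $c=\gcd(q-1,k)$. Then the centralizing subgroup of the conjugacy class of $M$ in $\mathrm{GL}_n(\mathbf{F}_q)$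 with respect to $\mathrm{SL}_n(\mathbf{F}_q)$, that is, $\mathrm{Cent}_{\mathrm{GL}_n(\mathbf{F}_q)}(M)\cdot \mathrm{SL}_n(\mathbf{F}_q)$, is the unique subgroup of index $c$ in $\mathrm{GL}_n(\mathbf{F}_q)$ containing $\mathrm{SL}_n(\mathbf{F}_q)$. -/

import Mathlib

open scoped Polynomial DirectSum Pointwise

/-- A cycle type over `K`: a finite set of monic irreducible polynomials, each of them carrying a
partition of a positive integer. -/
structure CycleType (K : Type*) [Field K] where
  polys : Finset K[X]
  monic : ∀ f ∈ polys, f.Monic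
  irreducible : ∀ f ∈ polys, Irreducible f
  size : polys → ℕ
  size_pos : ∀ f, 0 < size f
  part : (f : polys) → (size f).Partition

/-- A class type: a formal unordered string of terms `d ^ lam`, where `d` is a natural number and
`lam` is a partition. -/
abbrev ClassType : Type := Multiset (ℕ × (Σ m : ℕ, m.Partition))

/-- The class type of a cycle type: every polynomial is replaced by its degree. -/
def CycleType.toClassType {K : Type*} [Field K] (c : CycleType K) : ClassType :=
  c.polys.attach.val.map fun f => (f.1.natDegree, ⟨c.size f, c.part f⟩)

/-- The highest common factor of all parts of all partitions in a class type. -/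
def ClassType.partSizeInvariant (T : ClassType) : ℕ :=
  (T.bind fun t => t.2.2.parts).gcd

/-- `M` has cycle type `c`: the space `K ^ n`, with `X` acting as `M`, is the direct sum of cyclic
modules `K[X] / (f ^ h)`, one for every polynomial `f` of `c` and every part `h`
(with multiplicity) of the partition attached to `f`. -/
def Matrix.HasCycleType {K : Type*} [Field K] {n : ℕ} (M : Matrix (Fin n) (Fin n) K)
    (c : CycleType K) : Prop :=
  Nonempty (Module.AEval' (Matrix.toLin' M) ≃ₗ[K[X]]
    ⨁ i : (Σ f : c.polys, (c.part f).parts.ToType),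
      K[X] ⧸ Ideal.span {(i.1 : K[X]) ^ (i.2.1 : ℕ)})

/-- `M` has class type `T`. -/
def Matrix.HasClassType {K : Type*} [Field K] {n : ℕ} (M : Matrix (Fin n) (Fin n) K)
    (T : ClassType) : Prop :=
  ∃ c : CycleType K, M.HasCycleType c ∧ c.toClassType = T

/-- `M` has part-size invariant `k`. -/
def Matrix.HasPartSizeInvariant {K : Type*} [Field K] {n : ℕ} (M : Matrix (Fin n) (Fin n) K)
    (k : ℕ) : Prop :=
  ∃ T : ClassType, M.HasClassType T ∧ T.partSizeInvariant = k

theorem centralizer_sup_le_of_isConj {G : Type*} [Group G] (H : Subgroup G)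
    (hH : commutator G ≤ H) {a b : G} (hab : IsConj a b) :
    Subgroup.centralizer {a} ⊔ H ≤ Subgroup.centralizer {b} ⊔ H := by
  obtain ⟨x, rfl⟩ := isConj_iff.1 hab
  refine sup_le (fun y hy => ?_) le_sup_right
  have hy' : y * a = a * y := (Subgroup.mem_centralizer_singleton_iff.1 hy)
  have h1 : x * y * x⁻¹ ∈ Subgroup.centralizer {x * a * x⁻¹} := by
    rw [Subgroup.mem_centralizer_singleton_iff]
    calc x * y * x⁻¹ * (x * a * x⁻¹) = x * (y * a) * x⁻¹ := by group
      _ = x * a * x⁻¹ * (x * y * x⁻¹) := by rw [hy']; group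
  have h2 : (x * y * x⁻¹)⁻¹ * y ∈ H := by
    have : (x * y * x⁻¹)⁻¹ * y = x * y⁻¹ * x⁻¹ * (y⁻¹)⁻¹ := by group
    rw [this]
    exact hH (Subgroup.commutator_mem_commutator (g₁ := x) (g₂ := y⁻¹)
      (Subgroup.mem_top _) (Subgroup.mem_top _))
  have := mul_mem (Subgroup.mem_sup_left (T := H) h1) (Subgroup.mem_sup_right h2)
  rwa [mul_inv_cancel_left] at this

/-- The centralizing subgroup `Cent_G(g) · H` of a conjugacy class `C`, where `g` is any element
of `C`, and `H` is a (necessarily normal) subgroup of `G` with `G / H` abelian. -/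
def ConjClasses.centralizingSubgroup {G : Type*} [Group G] (H : Subgroup G)
    (hH : commutator G ≤ H) (C : ConjClasses G) : Subgroup G :=
  Quotient.liftOn C (fun g => Subgroup.centralizer {g} ⊔ H) fun _ _ h =>
    le_antisymm (centralizer_sup_le_of_isConj H hH h)
      (centralizer_sup_le_of_isConj H hH h.symm)

/-- The underlying set is the product set `Cent_G(g) · H`. -/
theorem ConjClasses.coe_centralizingSubgroup_mk {G : Type*} [Group G] (H : Subgroup G)
    (hH : commutator G ≤ H) (g : G) :
    ((ConjClasses.mk g).centralizingSubgroup H hH : Set G)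
      = (Subgroup.centralizer {g} : Set G) * (H : Set G) := by
  have : H.Normal := Subgroup.Normal.of_commutator_le G hH
  exact Subgroup.mul_normal _ _

/-- The subgroup `SL_n(K)` of `GL_n(K)`. -/
def slSubgroup (n : ℕ) (K : Type*) [Field K] : Subgroup (GL (Fin n) K) :=
  (Matrix.GeneralLinearGroup.det : GL (Fin n) K →* Kˣ).ker

theorem commutator_le_slSubgroup (n : ℕ) (K : Type*) [Field K] :
    commutator (GL (Fin n) K) ≤ slSubgroup n K :=
  Abelianization.commutator_subset_ker _

/-! The centralizing subgroup is the preimage under `det` of `D = det (Cent M)`, so everything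
reduces to `D` being the group of `k`-th powers (`map_det_centralizer_eq_range`); the unit group of
the field is cyclic, which gives the index and uniqueness. Every `k`-th power occurs: multiplication
by `u` on a summand `K[X]/(f^h)` has determinant `N(u mod f)^h`, and norms of finite fields are
surjective, so `D` contains the `h`-th powers for all parts `h`, hence the `k`-th powers. Nothing
else occurs: let `T` be the action of the product of all the `f`. A commuting `φ` preserves each
`ker T ⊓ range (T ^ i)`, and its determinant is the product of those on these layers. As `k` divides
all parts, the layers are constant on blocks of `k` consecutive `i`. -/

theorem LinearMap.det_eq_mul_of_exact {K A B C : Type*} [Field K] [AddCommGroup A] [Module K A]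
    [AddCommGroup B] [Module K B] [FiniteDimensional K B] [AddCommGroup C] [Module K C]
    {i : A →ₗ[K] B} {p : B →ₗ[K] C} (hi : Function.Injective i) (hp : Function.Surjective p)
    (hip : Function.Exact i p) {a : A →ₗ[K] A} {b : B →ₗ[K] B} {c : C →ₗ[K] C}
    (hab : ∀ x, b (i x) = i (a x)) (hbc : ∀ x, p (b x) = c (p x)) :
    b.det = a.det * c.det := by
  have hker : ∀ x, p x = 0 → p (b x) = 0 := fun x hx => by rw [hbc, hx, map_zero]
  have hb : LinearMap.ker p ≤ (LinearMap.ker p).comap b := fun x hx => hker x hx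
  rw [LinearMap.det_eq_det_mul_det (LinearMap.ker p) b hb]
  congr 1
  · let e : A ≃ₗ[K] LinearMap.ker p :=
      (LinearEquiv.ofInjective i hi).trans (LinearEquiv.ofEq _ _ hip.linearMap_ker_eq.symm)
    rw [← LinearMap.det_conj a e]
    congr 1
    ext x
    obtain ⟨y, rfl⟩ := e.surjective x
    simp only [LinearMap.comp_apply, LinearEquiv.coe_coe, LinearEquiv.symm_apply_apply]
    exact hab y
  · let e := p.quotKerEquivOfSurjective hp
    rw [← LinearMap.det_conj _ e]
    congr 1
    ext x
    obtain ⟨y, rfl⟩ := hp x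
    have : e.symm (p y) = Submodule.Quotient.mk y := by
      rw [LinearEquiv.symm_apply_eq]; rfl
    simp only [LinearMap.comp_apply, LinearEquiv.coe_coe, this]
    exact hbc y

/-! ### Determinants of maps commuting with a nilpotent operator -/

section Block

variable {K V : Type*} [Field K] [AddCommGroup V] [Module K V] {φ T : V →ₗ[K] V}

theorem LinearMap.mapsTo_range_pow_of_commute (h : Commute φ T) (i : ℕ) :
    ∀ x ∈ LinearMap.range (T ^ i), φ x ∈ LinearMap.range (T ^ i) := by
  rintro _ ⟨y, rfl⟩
  exact ⟨φ y, (LinearMap.congr_fun (h.pow_right i).eq y).symm⟩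

theorem LinearMap.mapsTo_ker_inf_range_pow_of_commute (h : Commute φ T) (i : ℕ) :
    ∀ x ∈ LinearMap.ker T ⊓ LinearMap.range (T ^ i),
      φ x ∈ LinearMap.ker T ⊓ LinearMap.range (T ^ i) := by
  rintro x ⟨hx, hx'⟩
  refine ⟨?_, mapsTo_range_pow_of_commute h i x hx'⟩
  have : φ (T x) = T (φ x) := LinearMap.congr_fun h.eq x
  rw [LinearMap.mem_ker.1 hx, map_zero] at this
  exact this.symm

theorem LinearMap.det_restrict_congr {W W' : Submodule K V} (h : W = W') (hW : ∀ x ∈ W, φ x ∈ W)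
    (hW' : ∀ x ∈ W', φ x ∈ W') : (φ.restrict hW).det = (φ.restrict hW').det := by
  subst h; rfl

variable [FiniteDimensional K V]

/-- Multiplication by `T` splits the determinant on the range of `T ^ i`. -/
theorem LinearMap.det_restrict_range_pow (h : Commute φ T) (i : ℕ) :
    (φ.restrict (mapsTo_range_pow_of_commute h i)).det =
      (φ.restrict (mapsTo_ker_inf_range_pow_of_commute h i)).det *
        (φ.restrict (mapsTo_range_pow_of_commute h (i + 1))).det := by
  have hT : ∀ x ∈ LinearMap.range (T ^ i), T x ∈ LinearMap.range (T ^ (i + 1)) := by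
    rintro _ ⟨y, rfl⟩
    exact ⟨y, by rw [pow_succ']; rfl⟩
  -- `T` maps `range (T ^ i)` onto `range (T ^ (i + 1))` with kernel `ker T ⊓ range (T ^ i)`.
  refine LinearMap.det_eq_mul_of_exact (i := Submodule.inclusion inf_le_right)
    (p := T.restrict hT) (Submodule.inclusion_injective _) ?_ ?_ ?_ ?_
  · rintro ⟨_, y, rfl⟩
    have hy : T ((T ^ i) y) = (T ^ (i + 1)) y := by rw [pow_succ']; rfl
    exact ⟨⟨_, y, rfl⟩, Subtype.ext hy⟩
  · rintro ⟨x, hx⟩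
    constructor
    · intro h0
      exact ⟨⟨x, congrArg Subtype.val h0, hx⟩, rfl⟩
    · rintro ⟨y, hy⟩
      rw [← hy]
      exact Subtype.ext y.2.1
  · intro x; rfl
  · intro x
    exact Subtype.ext (LinearMap.congr_fun h.eq x.1).symm

/-- If the kernel of a nilpotent operator `T` meets the ranges of the powers of `T` in a sequence of
subspaces that only drops at multiples of `k`, then every operator which commutes with `T`
has a `k`-th power as its determinant. -/
theorem LinearMap.exists_det_eq_pow_of_commute (h : Commute φ T) {k N : ℕ} (hk : 0 < k)
    (hN : T ^ N = 0)
    (hT : ∀ j y, y ∈ LinearMap.range (T ^ (j * k)) → T y = 0 →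
      y ∈ LinearMap.range (T ^ (j * k + (k - 1)))) :
    ∃ a : K, φ.det = a ^ k := by
  set d : ℕ → K := fun i => (φ.restrict (mapsTo_range_pow_of_commute h i)).det
  set a : ℕ → K := fun i => (φ.restrict (mapsTo_ker_inf_range_pow_of_commute h i)).det
  have hle : ∀ {m n}, m ≤ n → LinearMap.range (T ^ n) ≤ LinearMap.range (T ^ m) := by
    rintro m n hmn _ ⟨y, rfl⟩
    exact ⟨(T ^ (n - m)) y, by rw [← Module.End.mul_apply, ← pow_add, Nat.add_sub_cancel' hmn]⟩
  have haj : ∀ j r, r < k → a (j * k + r) = a (j * k) := by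
    intro j r hr
    have : LinearMap.ker T ⊓ LinearMap.range (T ^ (j * k + r)) =
        LinearMap.ker T ⊓ LinearMap.range (T ^ (j * k)) := by
      apply le_antisymm
      · exact inf_le_inf_left _ (hle (Nat.le_add_right _ _))
      · exact fun y hy => ⟨hy.1, hle (by omega) (hT j y hy.2 hy.1)⟩
    exact det_restrict_congr this _ _
  -- Each step peels off one layer, and all `k` layers of a block contribute the same factor.
  have hstep : ∀ j r, r ≤ k → d (j * k) = a (j * k) ^ r * d (j * k + r) := by
    intro j r
    induction r with
    | zero => simp
    | succ r ih =>
      intro hr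
      rw [ih (by omega), show d (j * k + r) = a (j * k + r) * d (j * k + r + 1) from
        det_restrict_range_pow h _, haj j r (by omega), pow_succ, mul_assoc, add_assoc]
  have hind : ∀ j, d 0 = (∏ m ∈ Finset.range j, a (m * k)) ^ k * d (j * k) := by
    intro j
    induction j with
    | zero => simp
    | succ j ih =>
      rw [ih, hstep j k le_rfl, Finset.prod_range_succ, mul_pow, mul_assoc, Nat.succ_mul]
  have hd0 : d 0 = φ.det := by
    have : LinearMap.range (T ^ 0) = ⊤ := by rw [pow_zero]; exact LinearMap.range_id
    exact (LinearMap.det_conj _ (LinearEquiv.ofTop _ this)).symm.trans rfl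
  have hdN : d (N * k) = 1 := by
    have : LinearMap.range (T ^ (N * k)) = ⊥ := by
      rw [pow_mul, hN, zero_pow hk.ne', LinearMap.range_zero]
    have : Subsingleton (LinearMap.range (T ^ (N * k))) := by rw [this]; infer_instance
    exact LinearMap.det_eq_one_of_subsingleton _
  exact ⟨_, by rw [← hd0, hind N, hdN, mul_one]⟩

end Block

/-! ### Subgroups of finite cyclic groups -/

theorem Subgroup.eq_of_le_of_index_eq {G : Type*} [Group G] [Finite G] {H L : Subgroup G}
    (h : H ≤ L) (hi : H.index = L.index) : H = L := by
  apply Subgroup.eq_of_le_of_card_ge h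
  have h1 := H.card_mul_index
  have h2 := L.card_mul_index
  rw [hi, ← h2] at h1
  exact (Nat.eq_of_mul_eq_mul_right (Nat.pos_of_ne_zero L.index_ne_zero_of_finite) h1).ge

/-- With `m` the index of `L`, all `m`-th powers lie in `L` and, by cyclicity, form a subgroup of
index `m`. Since `m ∣ k`, the `k`-th powers lie among them, again with index `m`. -/
theorem IsCyclic.eq_range_powMonoidHom {G : Type*} [CommGroup G] [IsCyclic G] [Finite G]
    {L : Subgroup G} {k : ℕ} (hL : L.index = (Nat.card G).gcd k) :
    L = (powMonoidHom k : G →* G).range := by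
  have h1 : (powMonoidHom L.index : G →* G).range.index = L.index := by
    rw [IsCyclic.index_powMonoidHom_range]
    exact Nat.gcd_eq_right L.index_dvd_card
  have h2 : (powMonoidHom k : G →* G).range.index = L.index := by
    rw [IsCyclic.index_powMonoidHom_range, hL]
  have h3 : (powMonoidHom L.index : G →* G).range ≤ L := by
    rintro _ ⟨x, rfl⟩
    exact L.pow_index_mem x
  have h4 : (powMonoidHom k : G →* G).range ≤ (powMonoidHom L.index : G →* G).range := by
    rintro _ ⟨x, rfl⟩
    obtain ⟨m, hm⟩ : L.index ∣ k := hL ▸ Nat.gcd_dvd_right _ _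
    refine ⟨x ^ m, ?_⟩
    simp only [powMonoidHom_apply]
    rw [← pow_mul, mul_comm, ← hm]
  rw [← Subgroup.eq_of_le_of_index_eq h3 h1, Subgroup.eq_of_le_of_index_eq h4 (h2.trans h1.symm)]

/-! ### Multiplication on `K[X]/(f^h)` -/

section Norm

variable {K : Type*} [Field K]

theorem Polynomial.Monic.finite_quotient_span {p : K[X]} (hp : p.Monic) :
    FiniteDimensional K (K[X] ⧸ Ideal.span {p}) :=
  hp.finite_adjoinRoot

/-- The determinant of multiplication by `u` on `K[X] ⧸ (p)` is multiplicative in `p`. -/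
theorem Polynomial.det_lsmul_quotient_mul {p q : K[X]} (hp : p.Monic) (hq : q.Monic) (u : K[X]) :
    LinearMap.det (Algebra.lsmul K K (K[X] ⧸ Ideal.span {p * q}) u) =
      LinearMap.det (Algebra.lsmul K K (K[X] ⧸ Ideal.span {q}) u) *
      LinearMap.det (Algebra.lsmul K K (K[X] ⧸ Ideal.span {p}) u) := by
  have := (hp.mul hq).finite_quotient_span
  have h1 : Ideal.span {q} ≤ Submodule.comap (LinearMap.lsmul K[X] K[X] p) (Ideal.span {p * q}) := by
    rw [Ideal.span_singleton_le_iff_mem, Submodule.mem_comap]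
    exact Ideal.mem_span_singleton_self _
  have h2 : Ideal.span {p * q} ≤ Submodule.comap LinearMap.id (Ideal.span {p}) := by
    rw [Submodule.comap_id, Ideal.span_singleton_le_span_singleton]
    exact dvd_mul_right _ _
  -- The sequence is `0 → K[X]/(q) → K[X]/(pq) → K[X]/(p) → 0`, whose first map is multiplication by
  -- `p`.
  refine LinearMap.det_eq_mul_of_exact
    (i := (Submodule.mapQ _ _ (LinearMap.lsmul K[X] K[X] p) h1).restrictScalars K)
    (p := (Submodule.mapQ _ _ LinearMap.id h2).restrictScalars K) ?_ ?_ ?_ ?_ ?_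
  · rw [injective_iff_map_eq_zero]
    intro x hx
    obtain ⟨x, rfl⟩ := Submodule.Quotient.mk_surjective _ x
    simp only [LinearMap.coe_restrictScalars, Submodule.mapQ_apply,
      Submodule.Quotient.mk_eq_zero, LinearMap.lsmul_apply, smul_eq_mul,
      Ideal.mem_span_singleton] at hx ⊢
    exact (mul_dvd_mul_iff_left hp.ne_zero).1 hx
  · intro x
    obtain ⟨x, rfl⟩ := Submodule.Quotient.mk_surjective _ x
    exact ⟨Submodule.Quotient.mk x, rfl⟩
  · intro x
    obtain ⟨x, rfl⟩ := Submodule.Quotient.mk_surjective _ x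
    constructor
    · intro hx
      simp only [LinearMap.coe_restrictScalars, Submodule.mapQ_apply, LinearMap.id_apply,
        Submodule.Quotient.mk_eq_zero, Ideal.mem_span_singleton] at hx
      obtain ⟨y, rfl⟩ := hx
      exact ⟨Submodule.Quotient.mk y, rfl⟩
    · rintro ⟨y, hy⟩
      obtain ⟨y, rfl⟩ := Submodule.Quotient.mk_surjective _ y
      rw [← hy]
      simp only [LinearMap.coe_restrictScalars, Submodule.mapQ_apply, LinearMap.id_apply,
        Submodule.Quotient.mk_eq_zero, LinearMap.lsmul_apply, smul_eq_mul,
        Ideal.mem_span_singleton]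
      exact dvd_mul_right _ _
  · intro x
    exact ((Submodule.mapQ _ _ (LinearMap.lsmul K[X] K[X] p) h1).map_smul u x).symm
  · intro x
    exact (Submodule.mapQ _ _ LinearMap.id h2).map_smul u x

theorem Polynomial.det_lsmul_quotient_pow {f : K[X]} (hf : f.Monic) (u : K[X]) (h : ℕ) :
    LinearMap.det (Algebra.lsmul K K (K[X] ⧸ Ideal.span {f ^ h}) u) =
      LinearMap.det (Algebra.lsmul K K (K[X] ⧸ Ideal.span {f}) u) ^ h := by
  induction h with
  | zero =>
    have : Subsingleton (K[X] ⧸ Ideal.span {f ^ 0}) := by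
      rw [pow_zero, Ideal.span_singleton_one]
      exact Submodule.Quotient.subsingleton_iff.2 rfl
    exact (LinearMap.det_eq_one_of_subsingleton _).trans (pow_zero _).symm
  | succ h ih => rw [pow_succ, det_lsmul_quotient_mul (hf.pow h) hf, ih, pow_succ']

theorem Polynomial.exists_det_lsmul_quotient_eq [Finite K] {f : K[X]} (hf : f.Monic)
    (hirr : Irreducible f) (a : K) :
    ∃ u : K[X], LinearMap.det (Algebra.lsmul K K (K[X] ⧸ Ideal.span {f}) u) = a := by
  have := Fact.mk hirr
  have : Module.Finite K (AdjoinRoot f) := hf.finite_adjoinRoot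
  have : Finite (AdjoinRoot f) := Module.finite_of_finite K
  obtain ⟨x, hx⟩ := FiniteField.norm_surjective K (AdjoinRoot f) a
  obtain ⟨u, rfl⟩ := AdjoinRoot.mk_surjective x
  refine ⟨u, ?_⟩
  rw [← hx, Algebra.norm_apply]
  congr 1

end Norm

/-! ### The layer condition on one cyclic summand -/

section Component

variable {R : Type*} [CommRing R] [IsDomain R]

/-- Here `u` is a unit modulo `f ^ h`. If `h > j * k`, then `k ∣ h` forces `h ≥ j * k + k`, so being
killed by `f ^ (j * k + 1)` makes `z` divisible by `f ^ (k - 1)`. -/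
theorem exists_pow_smul_eq_of_smul_pow_smul_eq_zero {f u : R} (hf : f ≠ 0) (hfu : IsCoprime f u)
    {h k : ℕ} (hk : 0 < k) (hkh : k ∣ h) (j : ℕ) (z : R ⧸ Ideal.span {f ^ h})
    (hz : (f * u) • (f * u) ^ (j * k) • z = 0) :
    ∃ w : R ⧸ Ideal.span {f ^ h}, (f * u) ^ (j * k) • z = (f * u) ^ (j * k + (k - 1)) • w := by
  obtain ⟨z, rfl⟩ := Submodule.Quotient.mk_surjective _ z
  obtain ⟨l, rfl⟩ := hkh
  rcases le_or_gt l j with hl | hl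
  · refine ⟨0, ?_⟩
    rw [smul_zero, ← Submodule.Quotient.mk_smul, Submodule.Quotient.mk_eq_zero,
      Ideal.mem_span_singleton, smul_eq_mul, mul_pow, mul_assoc]
    exact (pow_dvd_pow f (by rw [mul_comm]; exact Nat.mul_le_mul_right k hl)).mul_right _
  · have hle : j * k + k ≤ k * l := by
      rw [← Nat.succ_mul, mul_comm k]; exact Nat.mul_le_mul_right k hl
    rw [← Submodule.Quotient.mk_smul, ← Submodule.Quotient.mk_smul,
      Submodule.Quotient.mk_eq_zero, Ideal.mem_span_singleton, smul_eq_mul, smul_eq_mul,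
      ← mul_assoc, ← pow_succ', mul_pow, mul_assoc, mul_comm (u ^ _), ← mul_assoc] at hz
    have hz' := (hfu.pow (m := k * l) (n := j * k + 1)).dvd_of_dvd_mul_right hz
    have hz2 : f ^ (j * k + 1) * f ^ (k - 1) ∣ f ^ (j * k + 1) * z := by
      rw [← pow_add]
      exact (pow_dvd_pow f (by omega)).trans hz'
    obtain ⟨z', rfl⟩ := (mul_dvd_mul_iff_left (pow_ne_zero _ hf)).1 hz2
    -- `t` inverts `u ^ (k - 1)` modulo `f ^ (k * l)`.
    obtain ⟨s, t, hst⟩ := hfu.pow (m := k * l) (n := k - 1)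
    refine ⟨Submodule.Quotient.mk (t * z'), ?_⟩
    rw [← Submodule.Quotient.mk_smul, ← Submodule.Quotient.mk_smul, Submodule.Quotient.eq,
      Ideal.mem_span_singleton]
    refine ⟨(f * u) ^ (j * k) * f ^ (k - 1) * z' * s, ?_⟩
    simp only [smul_eq_mul, pow_add, mul_pow] 
    linear_combination (-(f ^ (j*k) * u ^ (j*k) * f ^ (k - 1) * z')) * hst

end Component

/-! ### Determinants of `K[X]`-endomorphisms -/

section Endomorphism

variable {K V ι : Type*} [Field K] [AddCommGroup V] [Module K V] [Module K[X] V]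
  [IsScalarTower K K[X] V] [FiniteDimensional K V] {f : ι → K[X]} {h : ι → ℕ}

/-- Multiplication on one of the summands gives an endomorphism of the whole module. -/
theorem Polynomial.exists_det_restrictScalars_eq_pow [Finite K]
    (e : V ≃ₗ[K[X]] Π i, K[X] ⧸ Ideal.span {f i ^ h i}) (i : ι) (hf : (f i).Monic)
    (hirr : Irreducible (f i)) (a : K) :
    ∃ φ : V →ₗ[K[X]] V, LinearMap.det (φ.restrictScalars K) = a ^ h i := by
  classical
  obtain ⟨u, hu⟩ := exists_det_lsmul_quotient_eq hf hirr a
  -- Multiplication by `u` on the `i`-th summand, the identity on the others.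
  let ψ : (Π i, K[X] ⧸ Ideal.span {f i ^ h i}) →ₗ[K[X]] (Π i, K[X] ⧸ Ideal.span {f i ^ h i}) :=
    LinearMap.id + (u - 1) • (LinearMap.single K[X] _ i ∘ₗ LinearMap.proj i)
  let φ : V →ₗ[K[X]] V := e.symm.toLinearMap ∘ₗ ψ ∘ₗ e.toLinearMap
  let p : V →ₗ[K[X]] K[X] ⧸ Ideal.span {f i ^ h i} := LinearMap.proj i ∘ₗ e.toLinearMap
  have hp : Function.Surjective p := (Function.surjective_eval i).comp e.surjective
  refine ⟨φ, ?_⟩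
  rw [← hu, ← det_lsmul_quotient_pow hf, LinearMap.det_eq_mul_of_exact
    (i := (LinearMap.ker (p.restrictScalars K)).subtype) (p := p.restrictScalars K)
    (a := LinearMap.id) (c := Algebra.lsmul K K _ u) Subtype.val_injective hp ?_ ?_ ?_,
    LinearMap.det_id, one_mul]
  · exact LinearMap.exact_subtype_ker_map _
  · rintro ⟨x, hx⟩
    have hx' : e x i = 0 := hx
    have : φ x = x := by simp [φ, ψ, hx']
    exact this
  · intro x
    simp [φ, ψ, p, sub_smul]

/-- Endomorphisms of a module all of whose elementary divisors are `k`-th powers. -/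
theorem Polynomial.exists_det_restrictScalars_eq_pow_of_dvd [Fintype ι]
    (e : V ≃ₗ[K[X]] Π i, K[X] ⧸ Ideal.span {f i ^ h i}) {S : Finset K[X]} (hfS : ∀ i, f i ∈ S)
    (hS : ∀ p ∈ S, p.Monic) (hirr : ∀ p ∈ S, Irreducible p) {k : ℕ} (hk : 0 < k)
    (hkh : ∀ i, k ∣ h i) (φ : V →ₗ[K[X]] V) :
    ∃ a : K, LinearMap.det (φ.restrictScalars K) = a ^ k := by
  classical
  set g : K[X] := ∏ p ∈ S, p
  have hpow : ∀ (m : ℕ) (x : V), ((Algebra.lsmul K K V g : V →ₗ[K] V) ^ m) x = g ^ m • x := by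
    intro m x
    rw [← map_pow, Algebra.lsmul_coe]
  have hsmul : ∀ (r : K[X]) (x : V) (i : ι), e (r • x) i = r • e x i := by
    intro r x i
    rw [e.map_smul, Pi.smul_apply]
  -- The sum of the `h i` serves only as an exponent at least as large as each of them.
  refine LinearMap.exists_det_eq_pow_of_commute (T := Algebra.lsmul K K V g) (k := k)
    (N := ∑ i, h i) ?_ hk ?_ ?_
  · ext x
    exact φ.map_smul g x
  · ext x
    rw [hpow, LinearMap.zero_apply]
    refine e.injective ?_
    refine _root_.funext fun i => ?_
    obtain ⟨z, hz⟩ := Submodule.Quotient.mk_surjective _ (e x i)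
    rw [hsmul, e.map_zero, ← hz, ← Submodule.Quotient.mk_smul, Pi.zero_apply,
      Submodule.Quotient.mk_eq_zero, Ideal.mem_span_singleton, smul_eq_mul]
    refine Dvd.dvd.mul_right ?_ _
    have hfg : f i ∣ g := Finset.dvd_prod_of_mem (fun p : K[X] => p) (hfS i)
    exact (pow_dvd_pow_of_dvd hfg _).trans
      (pow_dvd_pow g (Finset.single_le_sum (f := h) (fun _ _ => Nat.zero_le _) (Finset.mem_univ i)))
  · rintro j y ⟨z, rfl⟩ hz
    have key : ∀ i, ∃ w : K[X] ⧸ Ideal.span {f i ^ h i},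
        g ^ (j * k) • e z i = g ^ (j * k + (k - 1)) • w := by
      intro i
      have hgi : g = f i * ∏ p ∈ S.erase (f i), p := (Finset.mul_prod_erase S (fun p => p) (hfS i)).symm
      have hcop : IsCoprime (f i) (∏ p ∈ S.erase (f i), p) := by
        refine IsCoprime.prod_right fun p hp => ?_
        obtain ⟨hne, hpS⟩ := Finset.mem_erase.1 hp
        rw [(hirr _ (hfS i)).coprime_iff_not_dvd]
        intro hd
        exact hne (eq_of_monic_of_associated (hS _ (hfS i)) (hS _ hpS)
          ((hirr _ (hfS i)).associated_of_dvd (hirr _ hpS) hd)).symm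
      rw [hgi]
      refine exists_pow_smul_eq_of_smul_pow_smul_eq_zero (hirr _ (hfS i)).ne_zero hcop hk (hkh i)
        j _ ?_
      rw [← hgi]
      have := congrFun (congrArg e hz) i
      rwa [hpow, Algebra.lsmul_coe, hsmul, hsmul, e.map_zero] at this
    choose w hw using key
    refine ⟨e.symm w, ?_⟩
    rw [hpow, hpow]
    refine e.injective ?_
    refine _root_.funext fun i => ?_
    rw [hsmul, hsmul, e.apply_symm_apply]
    exact (hw i).symm

end Endomorphism

/-! ### Determinants on the centralizer -/

section Centralizer

variable {K : Type*} [Field K] {n : ℕ}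

/-- The determinants of the units of `End_{K[X]} (K ^ n)` are the ones of the centralizer. -/
theorem Matrix.exists_mem_centralizer_det_eq (M : GL (Fin n) K)
    (φ : Module.AEval' (Matrix.toLin' (M : Matrix (Fin n) (Fin n) K)) →ₗ[K[X]]
      Module.AEval' (Matrix.toLin' (M : Matrix (Fin n) (Fin n) K))) (a : Kˣ)
    (hφ : LinearMap.det (φ.restrictScalars K) = a) :
    ∃ A ∈ Subgroup.centralizer {M}, Matrix.GeneralLinearGroup.det A = a := by
  let o := Module.AEval'.of (Matrix.toLin' (M : Matrix (Fin n) (Fin n) K))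
  let ψ : (Fin n → K) →ₗ[K] (Fin n → K) :=
    o.symm.toLinearMap ∘ₗ φ.restrictScalars K ∘ₗ o.toLinearMap
  have hdet : (LinearMap.toMatrix' ψ).det = a := by
    rw [LinearMap.det_toMatrix', ← hφ]
    exact LinearMap.det_conj (φ.restrictScalars K) o.symm
  have hcomm : ψ * Matrix.toLin' M.1 = Matrix.toLin' M.1 * ψ := by
    refine LinearMap.ext fun x => o.injective ?_
    change o (o.symm (φ (o (Matrix.toLin' M.1 x)))) = o (Matrix.toLin' M.1 (o.symm (φ (o x))))
    rw [o.apply_symm_apply, ← Module.AEval'.X_smul_of, ← Module.AEval'.X_smul_of,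
      LinearEquiv.apply_symm_apply, map_smul]
  refine ⟨Matrix.GeneralLinearGroup.mk'' (LinearMap.toMatrix' ψ) (hdet ▸ a.isUnit), ?_, ?_⟩
  · rw [Subgroup.mem_centralizer_singleton_iff]
    apply Units.ext
    change LinearMap.toMatrix' ψ * M.1 = M.1 * LinearMap.toMatrix' ψ
    have := congrArg LinearMap.toMatrix' hcomm
    rwa [LinearMap.toMatrix'_mul, LinearMap.toMatrix'_mul, LinearMap.toMatrix'_toLin'] at this
  · exact Units.ext hdet

theorem Matrix.exists_det_eq_of_mem_centralizer (M A : GL (Fin n) K)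
    (hA : A ∈ Subgroup.centralizer {M}) :
    ∃ φ : Module.AEval' (Matrix.toLin' (M : Matrix (Fin n) (Fin n) K)) →ₗ[K[X]]
      Module.AEval' (Matrix.toLin' (M : Matrix (Fin n) (Fin n) K)),
      LinearMap.det (φ.restrictScalars K) = Matrix.GeneralLinearGroup.det A := by
  let o := Module.AEval'.of (Matrix.toLin' (M : Matrix (Fin n) (Fin n) K))
  have hcomm : A.1 * M.1 = M.1 * A.1 :=
    congrArg Units.val (Subgroup.mem_centralizer_singleton_iff.1 hA)
  let φ := LinearMap.ofAEval (Matrix.toLin' M.1) (o.toLinearMap ∘ₗ Matrix.toLin' A.1) (by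
    intro x
    change o (Matrix.toLin' A.1 (Matrix.toLin' M.1 x)) = Polynomial.X • o (Matrix.toLin' A.1 x)
    rw [Module.AEval'.X_smul_of, ← Matrix.toLin'_mul_apply, ← Matrix.toLin'_mul_apply, hcomm])
  refine ⟨φ, ?_⟩
  have : φ.restrictScalars K = o.toLinearMap ∘ₗ Matrix.toLin' A.1 ∘ₗ o.symm.toLinearMap := rfl
  rw [this, LinearMap.det_conj, LinearMap.det_toLin']
  rfl

theorem map_det_centralizer_eq_range [Finite K] (hn : 0 < n) (M : GL (Fin n) K) {k : ℕ}
    (hk : (M : Matrix (Fin n) (Fin n) K).HasPartSizeInvariant k) :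
    (Subgroup.centralizer {M}).map Matrix.GeneralLinearGroup.det =
      (powMonoidHom k : Kˣ →* Kˣ).range := by
  obtain ⟨_, ⟨c, ⟨e⟩, rfl⟩, rfl⟩ := hk
  let e' := e.trans (DirectSum.linearEquivFunOnFintype K[X] _ _)
  set T := c.toClassType
  have : FiniteDimensional K (Module.AEval' (Matrix.toLin' (M : Matrix (Fin n) (Fin n) K))) :=
    Module.Finite.equiv (Module.AEval'.of _)
  have hmem : ∀ (f : c.polys), ∀ m ∈ (c.part f).parts, m ∈ T.bind fun t => t.2.2.parts := by
    intro f m hm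
    rw [Multiset.mem_bind]
    exact ⟨_, Multiset.mem_map_of_mem _ (Finset.mem_attach _ f), hm⟩
  have hmem' : ∀ m ∈ T.bind fun t => t.2.2.parts, ∃ f, m ∈ (c.part f).parts := by
    intro m hm
    obtain ⟨t, ht, hm⟩ := Multiset.mem_bind.1 hm
    obtain ⟨f, -, rfl⟩ := Multiset.mem_map.1 ht
    exact ⟨f, hm⟩
  -- Parts are positive, so a zero gcd means that there are none; the module would then be zero,
  -- against `0 < n`.
  have hkpos : 0 < T.partSizeInvariant := by
    rw [Nat.pos_iff_ne_zero]
    intro h0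
    have h0 := (Multiset.gcd_eq_zero_iff _).1 h0
    have : IsEmpty (Σ f : c.polys, (c.part f).parts.ToType) := by
      refine ⟨fun i => ?_⟩
      have hi := Multiset.coe_mem (x := i.2)
      exact ((c.part i.1).parts_pos hi).ne' (h0 _ (hmem _ _ hi))
    have : Nonempty (Fin n) := ⟨⟨0, hn⟩⟩
    exact not_subsingleton (Fin n → K)
      ((Module.AEval'.of (Matrix.toLin' M.1)).toEquiv.trans e'.toEquiv).subsingleton
  apply le_antisymm
  · rintro _ ⟨A, hA, rfl⟩
    obtain ⟨φ, hφ⟩ := Matrix.exists_det_eq_of_mem_centralizer M A hA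
    obtain ⟨a, ha⟩ := Polynomial.exists_det_restrictScalars_eq_pow_of_dvd e' (S := c.polys)
      (fun i => i.1.2) c.monic c.irreducible hkpos
      (fun i => Multiset.gcd_dvd (hmem i.1 _ (Multiset.coe_mem (x := i.2)))) φ
    have ha0 : a ≠ 0 := by
      rintro rfl
      rw [hφ, zero_pow hkpos.ne'] at ha
      exact Units.ne_zero _ ha
    refine ⟨Units.mk0 a ha0, Units.ext ?_⟩
    rw [← hφ, ha]
    rfl
  · set D := (Subgroup.centralizer {M}).map Matrix.GeneralLinearGroup.det
    rintro _ ⟨a, rfl⟩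
    -- The order of `a` modulo `D` divides every part, hence their gcd; this replaces a Bézout
    -- combination.
    have hD : ∀ m ∈ T.bind fun t => t.2.2.parts, orderOf (a : Kˣ ⧸ D) ∣ m := by
      intro m hm
      obtain ⟨f, hm⟩ := hmem' m hm
      let x : (c.part f).parts.ToType := ⟨m, ⟨0, Multiset.count_pos.2 hm⟩⟩
      obtain ⟨φ, hφ⟩ := Polynomial.exists_det_restrictScalars_eq_pow e' ⟨f, x⟩ (c.monic _ f.2)
        (c.irreducible _ f.2) (a : K)
      obtain ⟨A, hA, hAa⟩ := Matrix.exists_mem_centralizer_det_eq M φ (a ^ m) (by rw [hφ]; rfl)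
      rw [orderOf_dvd_iff_pow_eq_one, ← QuotientGroup.mk_pow, QuotientGroup.eq_one_iff]
      exact ⟨A, hA, hAa⟩
    have := Multiset.dvd_gcd.2 hD
    rw [orderOf_dvd_iff_pow_eq_one, ← QuotientGroup.mk_pow, QuotientGroup.eq_one_iff] at this
    exact this

theorem Matrix.GeneralLinearGroup.det_surjective_of_pos (hn : 0 < n) :
    Function.Surjective (Matrix.GeneralLinearGroup.det : GL (Fin n) K →* Kˣ) := by
  intro a
  let D : Matrix (Fin n) (Fin n) K := Matrix.diagonal (Pi.mulSingle ⟨0, hn⟩ (a : K))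
  have hdet : D.det = a := by
    rw [Matrix.det_diagonal, Finset.prod_pi_mulSingle']
    simp
  exact ⟨Matrix.GeneralLinearGroup.mk'' D (hdet ▸ a.isUnit), Units.ext hdet⟩

end Centralizer

theorem mainTheorem7 {F : Type*} [Field F] [Fintype F] (n : ℕ) (hn : 0 < n)
    (M : GL (Fin n) F) (k : ℕ)
    (hk : (M : Matrix (Fin n) (Fin n) F).HasPartSizeInvariant k) (c : ℕ)
    (hc : c = Nat.gcd (Fintype.card F - 1) k) :
    slSubgroup n F ≤
        (ConjClasses.mk M).centralizingSubgroup (slSubgroup n F) (commutator_le_slSubgroup n F) ∧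
      ((ConjClasses.mk M).centralizingSubgroup (slSubgroup n F)
        (commutator_le_slSubgroup n F)).index = c ∧
      ∀ L : Subgroup (GL (Fin n) F), slSubgroup n F ≤ L → L.index = c →
        L = (ConjClasses.mk M).centralizingSubgroup (slSubgroup n F)
          (commutator_le_slSubgroup n F) := by
  set D := (Subgroup.centralizer {M}).map Matrix.GeneralLinearGroup.det
  have hsurj := Matrix.GeneralLinearGroup.det_surjective_of_pos (K := F) hn
  have hcent : (ConjClasses.mk M).centralizingSubgroup (slSubgroup n F)
      (commutator_le_slSubgroup n F) = D.comap Matrix.GeneralLinearGroup.det :=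
    (Subgroup.comap_map_eq _ _).symm
  have hDr : D = (powMonoidHom k : Fˣ →* Fˣ).range := map_det_centralizer_eq_range hn M hk
  have hcard : Nat.card Fˣ = Fintype.card F - 1 := by
    rw [Nat.card_units, Nat.card_eq_fintype_card]
  refine ⟨le_sup_right, ?_, fun L hL hLc => ?_⟩
  · rw [hcent, Subgroup.index_comap_of_surjective _ hsurj, hDr, IsCyclic.index_powMonoidHom_range,
      hcard, hc]
  -- Containing the kernel of `det`, `L` is recovered from its image, a subgroup of the same index
  -- in a cyclic group.
  · have hL' : (L.map Matrix.GeneralLinearGroup.det).comap Matrix.GeneralLinearGroup.det = L :=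
      Subgroup.comap_map_eq_self hL
    have hi : (L.map Matrix.GeneralLinearGroup.det).index = (Nat.card Fˣ).gcd k := by
      rw [hcard, ← hc, ← hLc, ← Subgroup.index_comap_of_surjective _ hsurj, hL']
    rw [hcent, hDr, ← IsCyclic.eq_range_powMonoidHom hi, hL']
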